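/- Let ${\mathbb K}$ be a field and let $E=(E^0,E^1,r,s)$ be a row-finite directed graph (every vertex emits only finitely many edges; $E^0$ and $E^1$ may be infinite). Let $L_{\mathbb K}(E)$ be the Leavitt path algebra of $E$, that is, the (not necessarily unital) associative ${\mathbb K}$-algebra generated by the vertices $v\in E^0$, the edges $e\in E^1$ and the ghost edges $e^*$ ($e\in E^1$), subject to the relations $vw=\delta_{v,w}v$ ($v,w\in E^0$), $s(e)e=e\,r(e)=e$ and $r(e)e^*=e^*s(e)=e^*$ ($e\in E^1$), $e^*f=\delta_{e,f}\,r(e)$ ($e,f\in E^1$), and $v=\sum_{s(e)=v}ee^*$ for every vertex $v$ that emits at least one and only finitely many edges. A cycle is a closed path $e_1\cdots e_n$ ($n\ge 1$) whose edges have pairwise distinct sources; cycles that differ only by the choice of the starting vertex are regarded as the same. An exit of a cycle $e_1\cdots e_n$ is an edge $e$ with $s(e)=s(e_i)$ and $e\ne e_i$ for some $i$. The graph $E$ is a comet if it has exactly one cycle $c$, from every vertex there is a path (possibly of length $0$) to a vertex of $c$, and every infinite path ends in $c$, that is, has the form $\mu ccc\cdots$ for a finite path $\mu$ (possibly of length $0$)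 and a suitable choice of starting vertex of $c$. The centroid $\mathcal C(A)$ of a ${\mathbb K}$-algebra $A$ is the ${\mathbb K}$-algebra, under composition, of all ${\mathbb K}$-linear maps $\tau\colon A\to A$ such that $\tau(xy)=\tau(x)y=x\tau(y)$ for all $x,y\in A$. Suppose that $L_{\mathbb K}(E)$ is prime (if $I,J$ are two-sided ideals with $IJ=0$, then $I=0$ or $J=0$), that $E$ has exactly one cycle, that this cycle has no exits, and that $E$ is not a comet. Then $\mathcal C(L_{\mathbb K}(E))\cong{\mathbb K}$ as ${\mathbb K}$-algebras. -/

import Mathlib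

/-- A directed graph with vertex set `V` and edge set `E` (arbitrary sets), given by its source
and range maps. -/
structure DirectedGraph (V : Type*) (E : Type*) where
  s : E → V
  r : E → V

namespace DirectedGraph

variable {V E : Type*} (G : DirectedGraph V E)

/-- Every vertex emits only finitely many edges. -/
def RowFinite : Prop := ∀ v : V, {e : E | G.s e = v}.Finite

/-- A regular vertex: neither a sink nor an infinite emitter. -/
def IsRegular (v : V) : Prop :=
  {e : E | G.s e = v}.Nonempty ∧ {e : E | G.s e = v}.Finite

/-- `u ≥ v`: there is a finite path, possibly of length zero, from `u` to `v`. -/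
def Connects (u v : V) : Prop :=
  Relation.ReflTransGen (fun a b => ∃ e : E, G.s e = a ∧ G.r e = b) u v

/-- The tree `T(u) = {v | u ≥ v}` of a vertex. -/
def tree (u : V) : Set V := {v | G.Connects u v}

/-- `e₁ … eₙ` with `n ≥ 1` and `r(eᵢ) = s(eᵢ₊₁)`. -/
def IsNontrivialPath (p : List E) : Prop :=
  p ≠ [] ∧ p.IsChain (fun e f => G.r e = G.s f)

/-- The vertices of a nontrivial path: all sources and ranges of its edges. -/
def pathVertices (p : List E) : Set V := {v | ∃ e ∈ p, G.s e = v ∨ G.r e = v}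

/-- A cycle: a closed nontrivial path whose edges have pairwise distinct sources. -/
def IsCycle (c : List E) : Prop :=
  G.IsNontrivialPath c ∧ (∃ h : c ≠ [], G.r (c.getLast h) = G.s (c.head h)) ∧ (c.map G.s).Nodup

/-- `c` is the only cycle of the graph. As usual, cycles that differ only by the choice of the base
vertex, that is, by a rotation of the sequence of edges, are regarded as the same cycle. -/
def IsUniqueCycle (c : List E) : Prop :=
  G.IsCycle c ∧ ∀ d : List E, G.IsCycle d → d ~r c

/-- Some edge leaves the path `p` at the source of one of its edges. -/
def HasExit (p : List E) : Prop := ∃ f ∈ p, ∃ e : E, G.s e = G.s f ∧ e ≠ f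

/-- An infinite path `f₀ f₁ f₂ …`. -/
def IsInfinitePath (f : ℕ → E) : Prop := ∀ n, G.r (f n) = G.s (f (n + 1))

/-- The infinite path `f` ends in the cycle `p`: it has the form `μ p p p …` for an initial
segment `μ`. -/
def EndsIn (f : ℕ → E) (p : List E) : Prop :=
  ∃ N, ∀ k, p[k % p.length]? = some (f (N + k))

/-- A comet: there is exactly one cycle, every vertex connects to it, and every infinite path ends
in it. -/
def IsComet : Prop :=
  ∃ c : List E, G.IsUniqueCycle c ∧ (∀ v, (G.tree v ∩ G.pathVertices c).Nonempty) ∧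
    ∀ f : ℕ → E, G.IsInfinitePath f → EndsIn f c

end DirectedGraph

/-- The generators of a Leavitt path algebra: vertices, real edges `e` and ghost edges `e*`. -/
inductive LeavittGen (V : Type*) (E : Type*)
  | vertex (v : V) : LeavittGen V E
  | edge (e : E) : LeavittGen V E
  | ghost (e : E) : LeavittGen V E

namespace LeavittGen

variable (K : Type*) [Field K] {V E : Type*}

/-- The free generators attached to vertices. -/
abbrev ιv (v : V) : FreeAlgebra K (LeavittGen V E) := FreeAlgebra.ι K (vertex v)

/-- The free generators attached to real edges. -/
abbrev ιe (e : E) : FreeAlgebra K (LeavittGen V E) := FreeAlgebra.ι K (edge e)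

/-- The free generators attached to ghost edges. -/
abbrev ιg (e : E) : FreeAlgebra K (LeavittGen V E) := FreeAlgebra.ι K (ghost e)

/-- The defining relations (V), (E1), (E2), (CK1), (CK2) of the Leavitt path algebra. -/
inductive Rel (G : DirectedGraph V E) :
    FreeAlgebra K (LeavittGen V E) → FreeAlgebra K (LeavittGen V E) → Prop
  | vertex_mul_self (v : V) : Rel G (ιv K v * ιv K v) (ιv K v)
  | vertex_mul_ne (v w : V) (h : v ≠ w) : Rel G (ιv K v * ιv K w) 0
  | source_mul_edge (e : E) : Rel G (ιv K (G.s e) * ιe K e) (ιe K e)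
  | edge_mul_range (e : E) : Rel G (ιe K e * ιv K (G.r e)) (ιe K e)
  | range_mul_ghost (e : E) : Rel G (ιv K (G.r e) * ιg K e) (ιg K e)
  | ghost_mul_source (e : E) : Rel G (ιg K e * ιv K (G.s e)) (ιg K e)
  | ck1_self (e : E) : Rel G (ιg K e * ιe K e) (ιv K (G.r e))
  | ck1_ne (e f : E) (h : e ≠ f) : Rel G (ιg K e * ιe K f) 0
  | ck2 (v : V) (h : G.IsRegular v) :
      Rel G (ιv K v) (∑ e ∈ h.2.toFinset, ιe K e * ιg K e)

end LeavittGen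

/-- The free *unital* `K`-algebra on vertices, edges and ghost edges modulo the Leavitt path algebra
relations. It is the unitization of the Leavitt path algebra, since no relation involves a constant
term. -/
abbrev UnitalLeavittPathAlgebra (K : Type*) [Field K] {V E : Type*} (G : DirectedGraph V E) :
    Type _ :=
  RingQuot (LeavittGen.Rel K G)

/-- The image of a generator. -/
def leavittGenerator (K : Type*) [Field K] {V E : Type*} (G : DirectedGraph V E)
    (x : LeavittGen V E) : UnitalLeavittPathAlgebra K G :=
  RingQuot.mkAlgHom K (LeavittGen.Rel K G) (FreeAlgebra.ι K x)

/-- The Leavitt path algebra `L_K(E)`: the (in general non-unital) `K`-algebra generated by vertices,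
edges and ghost edges subject to (V), (E1), (E2), (CK1), (CK2). It is realized as the non-unital
subalgebra that the generators span inside the unital algebra with the same presentation, and
`LeavittPathAlgebra.existsUnique_lift` shows that it has the universal property of the non-unital
presentation. -/
abbrev LeavittPathAlgebra (K : Type*) [Field K] {V E : Type*} (G : DirectedGraph V E) : Type _ :=
  NonUnitalAlgebra.adjoin K (Set.range (leavittGenerator K G))

namespace LeavittPathAlgebra

variable (K : Type*) [Field K] {V E : Type*} (G : DirectedGraph V E)

/-- A generator as an element of the Leavitt path algebra. -/
def gen (x : LeavittGen V E) : LeavittPathAlgebra K G :=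
  ⟨leavittGenerator K G x, NonUnitalAlgebra.subset_adjoin K (Set.mem_range_self x)⟩

/-- Elements `P v`, `S e`, `S' e` of a `K`-algebra `B` satisfying the Leavitt path algebra
relations. -/
structure IsLeavittFamily {B : Type*} [NonUnitalRing B] (P : V → B) (S S' : E → B) : Prop where
  vertex_mul_self : ∀ v, P v * P v = P v
  vertex_mul_ne : ∀ v w, v ≠ w → P v * P w = 0
  source_mul_edge : ∀ e, P (G.s e) * S e = S e
  edge_mul_range : ∀ e, S e * P (G.r e) = S e
  range_mul_ghost : ∀ e, P (G.r e) * S' e = S' e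
  ghost_mul_source : ∀ e, S' e * P (G.s e) = S' e
  ck1_self : ∀ e, S' e * S e = P (G.r e)
  ck1_ne : ∀ e f, e ≠ f → S' e * S f = 0
  ck2 : ∀ v (h : G.IsRegular v), P v = ∑ e ∈ h.2.toFinset, S e * S' e

/-- The generators of the Leavitt path algebra form a Leavitt family. -/
theorem isLeavittFamily_gen :
    IsLeavittFamily G (fun v => gen K G (.vertex v)) (fun e => gen K G (.edge e))
      (fun e => gen K G (.ghost e)) := by
  have key : ∀ {a b}, LeavittGen.Rel K G a b →
      RingQuot.mkAlgHom K (LeavittGen.Rel K G) a = RingQuot.mkAlgHom K (LeavittGen.Rel K G) b :=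
    fun h => RingQuot.mkAlgHom_rel K h
  constructor
  · intro v; ext; simpa [gen, leavittGenerator] using key (.vertex_mul_self v)
  · intro v w h; ext; simpa [gen, leavittGenerator] using key (.vertex_mul_ne v w h)
  · intro e; ext; simpa [gen, leavittGenerator] using key (.source_mul_edge e)
  · intro e; ext; simpa [gen, leavittGenerator] using key (.edge_mul_range e)
  · intro e; ext; simpa [gen, leavittGenerator] using key (.range_mul_ghost e)
  · intro e; ext; simpa [gen, leavittGenerator] using key (.ghost_mul_source e)
  · intro e; ext; simpa [gen, leavittGenerator] using key (.ck1_self e)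
  · intro e f h; ext; simpa [gen, leavittGenerator] using key (.ck1_ne e f h)
  · intro v h; ext
    simpa [gen, leavittGenerator, AddSubmonoidClass.coe_finsetSum] using key (.ck2 v h)

/-- The universal property of the Leavitt path algebra among all (not necessarily unital)
associative `K`-algebras. -/
theorem existsUnique_lift {B : Type*} [NonUnitalRing B] [Module K B] [IsScalarTower K B B]
    [SMulCommClass K B B] (P : V → B) (S S' : E → B) (h : IsLeavittFamily G P S S') :
    ∃! φ : LeavittPathAlgebra K G →ₙₐ[K] B, (∀ v, φ (gen K G (.vertex v)) = P v) ∧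
      (∀ e, φ (gen K G (.edge e)) = S e) ∧ ∀ e, φ (gen K G (.ghost e)) = S' e := by
  let g : LeavittGen V E → B := fun x => match x with
    | .vertex v => P v
    | .edge e => S e
    | .ghost e => S' e
  let F : FreeAlgebra K (LeavittGen V E) →ₐ[K] Unitization K B :=
    FreeAlgebra.lift K (fun x => (g x : Unitization K B))
  have hF : ∀ ⦃a b⦄, LeavittGen.Rel K G a b → F a = F b := by
    intro a b hab
    induction hab with
    | vertex_mul_self v => simp [F, g, ← Unitization.inr_mul, h.vertex_mul_self]
    | vertex_mul_ne v w hvw => simp [F, g, ← Unitization.inr_mul, h.vertex_mul_ne v w hvw]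
    | source_mul_edge e => simp [F, g, ← Unitization.inr_mul, h.source_mul_edge]
    | edge_mul_range e => simp [F, g, ← Unitization.inr_mul, h.edge_mul_range]
    | range_mul_ghost e => simp [F, g, ← Unitization.inr_mul, h.range_mul_ghost]
    | ghost_mul_source e => simp [F, g, ← Unitization.inr_mul, h.ghost_mul_source]
    | ck1_self e => simp [F, g, ← Unitization.inr_mul, h.ck1_self]
    | ck1_ne e f hef => simp [F, g, ← Unitization.inr_mul, h.ck1_ne e f hef]
    | ck2 v hv =>
      have := congrArg (Unitization.inrHom K K B) (h.ck2 v hv)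
      simpa [F, g, map_sum] using this
  let Φ : UnitalLeavittPathAlgebra K G →ₐ[K] Unitization K B := RingQuot.liftAlgHom K ⟨F, hF⟩
  have hΦ : ∀ x, Φ (leavittGenerator K G x) = (g x : Unitization K B) := by
    intro x
    simp [Φ, leavittGenerator, F]
  have hr : ∀ a : LeavittPathAlgebra K G, ∃ b : B, Φ a = (b : Unitization K B) := by
    rintro ⟨a, ha⟩
    induction ha using NonUnitalAlgebra.adjoin_induction with
    | mem x hx => obtain ⟨y, rfl⟩ := hx; exact ⟨g y, hΦ y⟩
    | add x y _ _ hx hy =>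
      obtain ⟨a, ha⟩ := hx; obtain ⟨b, hb⟩ := hy
      exact ⟨a + b, by simp_all⟩
    | zero => exact ⟨0, by simp⟩
    | mul x y _ _ hx hy =>
      obtain ⟨a, ha⟩ := hx; obtain ⟨b, hb⟩ := hy
      exact ⟨a * b, by simp_all⟩
    | smul k x _ hx =>
      obtain ⟨a, ha⟩ := hx
      exact ⟨k • a, by simp_all⟩
  choose φ hφ using hr
  have inj : Function.Injective ((↑) : B → Unitization K B) := Unitization.inr_injective
  refine ⟨{ toFun := φ, map_smul' := ?_, map_zero' := ?_, map_add' := ?_, map_mul' := ?_ },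
    ⟨?_, ?_, ?_⟩, ?_⟩
  · intro k a; apply inj; simp [← hφ]
  · apply inj; simp [← hφ]
  · intro a b; apply inj; simp [← hφ]
  · intro a b; apply inj; simp [← hφ]
  · intro v; apply inj; exact (hφ _).symm.trans (hΦ _)
  · intro v; apply inj; exact (hφ _).symm.trans (hΦ _)
  · intro v; apply inj; exact (hφ _).symm.trans (hΦ _)
  · rintro ψ ⟨h1, h2, h3⟩
    ext ⟨a, ha⟩
    apply inj
    refine Eq.trans ?_ (hφ _)
    induction ha using NonUnitalAlgebra.adjoin_induction with
    | mem x hx =>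
      obtain ⟨y, rfl⟩ := hx
      refine Eq.trans ?_ (hΦ y).symm
      cases y with
      | vertex v => exact congrArg _ (h1 v)
      | edge v => exact congrArg _ (h2 v)
      | ghost v => exact congrArg _ (h3 v)
    | add x y hx hy ix iy =>
      have := map_add ψ ⟨x, hx⟩ ⟨y, hy⟩
      simp_all
    | zero =>
      have h0 : ψ ⟨0, zero_mem _⟩ = 0 := map_zero ψ
      rw [h0, map_zero, Unitization.inr_zero]
    | mul x y hx hy ix iy =>
      have := map_mul ψ ⟨x, hx⟩ ⟨y, hy⟩
      simp_all
    | smul k x hx ix =>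
      have := map_smul ψ k ⟨x, hx⟩
      simp_all

end LeavittPathAlgebra

/-- A (not necessarily unital) ring is prime if `I J = 0` implies `I = 0` or `J = 0` for two-sided
ideals `I`, `J`. -/
def IsPrimeRing (A : Type*) [NonUnitalRing A] : Prop :=
  ∀ I J : TwoSidedIdeal A, (∀ x ∈ I, ∀ y ∈ J, x * y = 0) → I = ⊥ ∨ J = ⊥

/-- The centroid of a (not necessarily unital) `K`-algebra `A`: the `K`-algebra, under composition,
of all `K`-linear maps `τ : A → A` with `τ (x y) = τ x y = x τ y`. -/
def centroid (K : Type*) [Field K] (A : Type*) [NonUnitalRing A] [Module K A]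
    [IsScalarTower K A A] [SMulCommClass K A A] : Subalgebra K (Module.End K A) where
  carrier := {τ | ∀ x y : A, τ (x * y) = τ x * y ∧ τ (x * y) = x * τ y}
  mul_mem' {σ τ} hσ hτ x y := by
    constructor
    · rw [Module.End.mul_apply, Module.End.mul_apply, (hτ x y).1, (hσ _ y).1]
    · rw [Module.End.mul_apply, Module.End.mul_apply, (hτ x y).2, (hσ x _).2]
  add_mem' {σ τ} hσ hτ x y := by
    constructor
    · rw [LinearMap.add_apply, LinearMap.add_apply, (hσ x y).1, (hτ x y).1, add_mul]
    · rw [LinearMap.add_apply, LinearMap.add_apply, (hσ x y).2, (hτ x y).2, mul_add]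
  algebraMap_mem' k x y := by
    simp only [Module.algebraMap_end_apply, smul_mul_assoc, mul_smul_comm, and_self]

/-! Primeness makes the centroid rigid: for `τ` in the centroid, the kernel and the image of `τ` are
two-sided ideals with product zero, so a nonzero `τ` is injective. Hence an element of the centroid
that agrees with a scalar at one nonzero element is that scalar (`eq_algebraMap_of_mem_centroid`),
and it suffices to find a vertex `v` with `τ v = k • v`.

Primeness also forces any two vertices to have a common descendant (`exists_common_descendant`).
Taking one of them on the cycle, which cannot be left for want of exits, shows that every vertex
connects to the cycle. Since the graph is not a comet, some infinite path does not end in the cycle.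
It never meets the cycle, and a repeated vertex would produce a cycle on it, so its vertices are
distinct.

Let `γ` be the initial segment of length `n` of such a path, from `v₀` to `vₙ`. For `n` large, `γ* x
γ` is a scalar multiple of `vₙ`: a monomial `p q*` survives only if `p` and `q` are both initial
segments of the path, and as they have the same range and vertices do not repeat, `p = q`
(`exists_compression_eq_smul`). With `x = τ v₀` this gives `τ vₙ = τ (γ* v₀ γ) = γ* (τ v₀) γ = k •
vₙ`. Vertices are nonzero by an explicit representation (`gen_vertex_ne_zero`). -/

namespace DirectedGraph

/-! ### A representation in which every vertex acts nontrivially -/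

variable {V E : Type*} (G : DirectedGraph V E)

/-- In a row-finite graph, `V × ℕ` decomposes over each non-sink `v` into copies of `ℕ` indexed by
the edges that `v` emits. -/
theorem RowFinite.exists_branching {G : DirectedGraph V E} (hrow : G.RowFinite) :
    ∃ φ : E × ℕ → V × ℕ, Function.Injective φ ∧ (∀ x, (φ x).1 = G.s x.1) ∧
      ∀ e n, ∃ x, φ x = (G.s e, n) := by
  have key : ∀ v, ∃ ψ : {e : E // G.s e = v} × ℕ → ℕ, Function.Injective ψ ∧
      (Nonempty {e : E // G.s e = v} → Function.Surjective ψ) := by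
    intro v
    have : Finite {e : E // G.s e = v} := hrow v
    by_cases hne : Nonempty {e : E // G.s e = v}
    · obtain ⟨eqv⟩ := nonempty_equiv_of_countable (α := {e : E // G.s e = v} × ℕ) (β := ℕ)
      exact ⟨eqv, eqv.injective, fun _ => eqv.surjective⟩
    · exact ⟨fun _ => 0, fun x => (hne ⟨x.1⟩).elim, fun h => (hne h).elim⟩
  choose ψ hinj hsurj using key
  -- Moves the edge into the fibre over a fixed `v`, so that injectivity of the single map `ψ v`
  -- applies to two edges whose sources are only propositionally equal.
  have transport : ∀ e n v (h : G.s e = v), ψ (G.s e) (⟨e, rfl⟩, n) = ψ v (⟨e, h⟩, n) := by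
    rintro e n _ rfl; rfl
  refine ⟨fun x => (G.s x.1, ψ (G.s x.1) (⟨x.1, rfl⟩, x.2)), ?_, fun _ => rfl, ?_⟩
  · rintro ⟨e, n⟩ ⟨e', n'⟩ h
    obtain ⟨h1, h2⟩ := Prod.mk.inj h
    dsimp only at h1 h2
    rw [transport e n _ h1] at h2
    have := hinj _ h2
    simp only [Prod.mk.injEq, Subtype.mk.injEq] at this
    rw [this.1, this.2]
  · intro e n
    obtain ⟨⟨⟨e', he'⟩, m⟩, hx⟩ := hsurj (G.s e) ⟨⟨e, rfl⟩⟩ n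
    refine ⟨(e', m), ?_⟩
    dsimp only
    rw [transport e' m _ he', hx, he']

end DirectedGraph

namespace LeavittPathAlgebra

variable {K : Type*} [Field K] {V E : Type*} {G : DirectedGraph V E}

open Classical in
/-- The vertices of a row-finite graph are nonzero in its Leavitt path algebra. -/
theorem gen_vertex_ne_zero (hrow : G.RowFinite) (v : V) : gen K G (.vertex v) ≠ 0 := by
  obtain ⟨φ, hφ, hφs, hφr⟩ := hrow.exists_branching
  let P : V → Module.End K (V × ℕ → K) := fun v =>
    { toFun := fun f x => if x.1 = v then f x else 0
      map_add' := fun f g => by ext x; by_cases h : x.1 = v <;> simp [h]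
      map_smul' := fun k f => by ext x; by_cases h : x.1 = v <;> simp [h] }
  -- `S e` carries the values on `{G.r e} × ℕ` to the image of `φ (e, ·)`, and `S' e` carries them
  -- back. (CK1) and (CK2) then say that these images are disjoint and, over a regular vertex `v`,
  -- exhaust `{v} × ℕ`.
  let S : E → Module.End K (V × ℕ → K) := fun e =>
    { toFun := fun f x => if h : ∃ n, φ (e, n) = x then f (G.r e, h.choose) else 0
      map_add' := fun f g => by ext x; by_cases h : ∃ n, φ (e, n) = x <;> simp [h]
      map_smul' := fun k f => by ext x; by_cases h : ∃ n, φ (e, n) = x <;> simp [h] }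
  let S' : E → Module.End K (V × ℕ → K) := fun e =>
    { toFun := fun f x => if x.1 = G.r e then f (φ (e, x.2)) else 0
      map_add' := fun f g => by ext x; by_cases h : x.1 = G.r e <;> simp [h]
      map_smul' := fun k f => by ext x; by_cases h : x.1 = G.r e <;> simp [h] }
  have hP : ∀ v f x, P v f x = if x.1 = v then f x else 0 := fun _ _ _ => rfl
  have hS' : ∀ e f x, S' e f x = if x.1 = G.r e then f (φ (e, x.2)) else 0 := fun _ _ _ => rfl
  have hS : ∀ e f n, S e f (φ (e, n)) = f (G.r e, n) := by
    intro e f n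
    have h : ∃ m, φ (e, m) = φ (e, n) := ⟨n, rfl⟩
    have hn : h.choose = n := (Prod.mk.inj (hφ h.choose_spec)).2
    change (if h : ∃ m, φ (e, m) = φ (e, n) then f (G.r e, h.choose) else 0) = _
    rw [dif_pos h, hn]
  have hS0 : ∀ e f x, (∀ n, φ (e, n) ≠ x) → S e f x = 0 := by
    intro e f x h
    exact dif_neg (fun ⟨n, hn⟩ => h n hn)
  have hS1 : ∀ e f e' n, e ≠ e' → S e f (φ (e', n)) = 0 := by
    intro e f e' n h
    exact hS0 _ _ _ fun m hm => h (Prod.mk.inj (hφ hm)).1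
  have fam : IsLeavittFamily G P S S' := by
    constructor
    · intro v; ext1 f; ext x
      by_cases h : x.1 = v <;> simp [hP, h]
    · intro v w hvw; ext1 f; ext x
      by_cases h : x.1 = v
      · have : x.1 ≠ w := fun h' => hvw (h.symm.trans h')
        simp [hP, this]
      · simp [hP, h]
    · intro e; ext1 f; ext x
      by_cases h : ∃ n, φ (e, n) = x
      · obtain ⟨n, rfl⟩ := h
        simp [hP, hφs]
      · push Not at h
        simp [hP, hS0 e f x h]
    · intro e; ext1 f; ext x
      by_cases h : ∃ n, φ (e, n) = x
      · obtain ⟨n, rfl⟩ := h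
        simp [hP, hS]
      · push Not at h
        simp [hS0 e _ x h]
    · intro e; ext1 f; ext x
      by_cases h : x.1 = G.r e <;> simp [hP, hS', h]
    · intro e; ext1 f; ext x
      by_cases h : x.1 = G.r e <;> simp [hP, hS', h, hφs]
    · intro e; ext1 f; ext ⟨w, n⟩
      by_cases h : w = G.r e
      · subst h
        simp [hP, hS', hS]
      · simp [hP, hS', h]
    · intro e e' hne; ext1 f; ext x
      by_cases h : x.1 = G.r e
      · simp [hS', h, hS1 e' f e _ (Ne.symm hne)]
      · simp [hS', h]
    · intro v h; ext1 f; ext x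
      simp only [hP, LinearMap.sum_apply, Finset.sum_apply, Module.End.mul_apply]
      by_cases hx : x.1 = v
      · obtain ⟨e₀, he₀⟩ := h.1
        obtain ⟨⟨e, n⟩, hy⟩ := hφr e₀ x.2
        have hxe : x = φ (e, n) := by rw [hy, he₀, ← hx]
        have hev : G.s e = v := by rw [← hx, hxe, hφs]
        rw [if_pos hx, hxe, Finset.sum_eq_single e]
        · simp [hS, hS']
        · intro e' _ he'
          exact hS1 _ _ _ _ he'
        · intro h'
          simp [hev] at h'
      · rw [if_neg hx]
        refine (Finset.sum_eq_zero fun e he => hS0 _ _ _ fun n hn => hx ?_).symm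
        rw [← hn, hφs]
        simpa using he
  obtain ⟨F, ⟨hF, -⟩, -⟩ := existsUnique_lift K G P S S' fam
  intro h0
  have h1 := hF v
  rw [h0, map_zero] at h1
  have h2 := congrFun (congrArg (fun T : Module.End K (V × ℕ → K) => T (fun _ => 1)) h1) (v, 0)
  simp [hP] at h2

end LeavittPathAlgebra

/-! ### Prime rings and their centroids -/

section Centroid

variable {A : Type*} [NonUnitalRing A]

/-- In a prime ring, `u A w = 0` with `u` idempotent forces `u = 0` or `w = 0`. -/
theorem IsPrimeRing.eq_zero_or_eq_zero (hA : IsPrimeRing A) {u w : A} (hu : u * u = u)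
    (h : ∀ a, u * a * w = 0) : u = 0 ∨ w = 0 := by
  let J : TwoSidedIdeal A := TwoSidedIdeal.mk' {y | ∀ a, u * a * y = 0}
    (fun a => by simp)
    (fun hx hy a => by rw [mul_add, hx, hy, add_zero])
    (fun hx a => by rw [mul_neg, hx, neg_zero])
    (fun {x y} hy a => by rw [← mul_assoc, mul_assoc u]; exact hy _)
    (fun hx a => by rw [← mul_assoc, hx, zero_mul])
  have memJ : ∀ y, y ∈ J ↔ ∀ a, u * a * y = 0 := fun y => TwoSidedIdeal.mem_mk' ..
  -- The left annihilator of `J` replaces the ideal generated by `u`; it contains `u` because `u * y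
  -- = u * u * y = 0` for `y ∈ J`.
  let I : TwoSidedIdeal A := TwoSidedIdeal.mk' {x | ∀ y ∈ J, x * y = 0}
    (fun a _ => by simp)
    (fun hx hy a ha => by rw [add_mul, hx _ ha, hy _ ha, add_zero])
    (fun hx a ha => by rw [neg_mul, hx _ ha, neg_zero])
    (fun {x y} hy a ha => by rw [mul_assoc, hy _ ha, mul_zero])
    (fun {x y} hx a ha => by rw [mul_assoc, hx _ (J.mul_mem_left _ _ ha)])
  have memI : ∀ x, x ∈ I ↔ ∀ y ∈ J, x * y = 0 := fun y => TwoSidedIdeal.mem_mk' ..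
  rcases hA I J fun x hx y hy => (memI x).1 hx y hy with h0 | h0
  · left
    have : u ∈ I := (memI u).2 fun y hy => by simpa [hu] using (memJ y).1 hy u
    rwa [h0, TwoSidedIdeal.mem_bot] at this
  · right
    have : w ∈ J := (memJ w).2 h
    rwa [h0, TwoSidedIdeal.mem_bot] at this

variable {K : Type*} [Field K] [Module K A] [IsScalarTower K A A] [SMulCommClass K A A]

/-- Over a prime algebra, an element of the centroid that kills a nonzero element is zero. -/
theorem eq_zero_of_mem_centroid (hA : IsPrimeRing A) {τ : Module.End K A} (hτ : τ ∈ centroid K A)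
    {x : A} (hx : x ≠ 0) (hτx : τ x = 0) : τ = 0 := by
  have h1 : ∀ x y, τ (x * y) = τ x * y := fun x y => (hτ x y).1
  have h2 : ∀ x y, τ (x * y) = x * τ y := fun x y => (hτ x y).2
  let I : TwoSidedIdeal A := TwoSidedIdeal.mk' {x | τ x = 0}
    (map_zero τ)
    (fun {x y} hx hy => by change τ (x + y) = 0; rw [map_add, hx, hy, add_zero])
    (fun {x} hx => by change τ (-x) = 0; rw [map_neg, hx, neg_zero])
    (fun {x y} hy => by change τ (x * y) = 0; rw [h2, hy, mul_zero])
    (fun {x y} hx => by change τ (x * y) = 0; rw [h1, hx, zero_mul])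
  have memI : ∀ y, y ∈ I ↔ τ y = 0 := fun y => TwoSidedIdeal.mem_mk' ..
  let J : TwoSidedIdeal A := TwoSidedIdeal.mk' (Set.range τ)
    ⟨0, map_zero τ⟩
    (by rintro _ _ ⟨x, rfl⟩ ⟨y, rfl⟩; exact ⟨x + y, map_add τ x y⟩)
    (by rintro _ ⟨x, rfl⟩; exact ⟨-x, map_neg τ x⟩)
    (by rintro x _ ⟨y, rfl⟩; exact ⟨x * y, h2 x y⟩)
    (by rintro _ y ⟨x, rfl⟩; exact ⟨x * y, h1 x y⟩)
  have memJ : ∀ y, y ∈ J ↔ y ∈ Set.range τ := fun y => TwoSidedIdeal.mem_mk' ..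
  have hIJ : ∀ x ∈ I, ∀ y ∈ J, x * y = 0 := by
    intro x hx y hy
    obtain ⟨z, rfl⟩ := (memJ y).1 hy
    -- Kernel times image vanishes: `x * τ z = τ (x * z) = τ x * z = 0`.
    rw [← h2, h1, (memI x).1 hx, zero_mul]
  rcases hA I J hIJ with h0 | h0
  · have : x ∈ I := (memI x).2 hτx
    rw [h0, TwoSidedIdeal.mem_bot] at this
    exact (hx this).elim
  · ext z
    have : τ z ∈ J := (memJ _).2 ⟨z, rfl⟩
    rw [h0, TwoSidedIdeal.mem_bot] at this
    simpa using this

/-- Over a prime algebra, an element of the centroid that acts as a scalar on a nonzero element is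
that scalar. -/
theorem eq_algebraMap_of_mem_centroid (hA : IsPrimeRing A) {τ : Module.End K A}
    (hτ : τ ∈ centroid K A) {x : A} (hx : x ≠ 0) {k : K} (hτx : τ x = k • x) :
    τ = algebraMap K (Module.End K A) k := by
  refine sub_eq_zero.1 (eq_zero_of_mem_centroid hA
    (sub_mem hτ (algebraMap_mem (centroid K A) k)) hx ?_)
  rw [LinearMap.sub_apply, hτx, Module.algebraMap_end_apply, sub_self]

/-- If every element of the centroid of a nonzero algebra is a scalar, the centroid is the base
field. -/
theorem nonempty_centroid_algEquiv [Nontrivial A]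
    (h : ∀ τ ∈ centroid K A, ∃ k : K, τ = algebraMap K (Module.End K A) k) :
    Nonempty (centroid K A ≃ₐ[K] K) := by
  refine ⟨(AlgEquiv.ofBijective (Algebra.ofId K (centroid K A)) ⟨?_, ?_⟩).symm⟩
  · exact (Algebra.ofId K (centroid K A)).toRingHom.injective
  · rintro ⟨τ, hτ⟩
    obtain ⟨k, hk⟩ := h τ hτ
    exact ⟨k, Subtype.ext hk.symm⟩

end Centroid

/-! ### Finite paths, infinite paths and cycles without exits -/

namespace DirectedGraph

variable {V E : Type*}

/-- `G.IsPath u p w`: the list of edges `p` is a finite path from `u` to `w`. -/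
inductive IsPath (G : DirectedGraph V E) : V → List E → V → Prop
  | nil (v : V) : IsPath G v [] v
  | cons (e : E) {p : List E} {w : V} (h : IsPath G (G.r e) p w) : IsPath G (G.s e) (e :: p) w

variable {G : DirectedGraph V E}

theorem IsPath.connects {u w : V} {p : List E} (h : G.IsPath u p w) : G.Connects u w := by
  induction h with
  | nil v => exact .refl
  | cons e _ ih => exact .head ⟨e, rfl, rfl⟩ ih

theorem IsPath.snoc {u : V} {p : List E} {e : E} (h : G.IsPath u p (G.s e)) :
    G.IsPath u (p ++ [e]) (G.r e) := by
  generalize hw : G.s e = w at h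
  induction h with
  | nil v => subst hw; exact .cons e (.nil _)
  | cons f _ ih => exact .cons f (ih hw)

theorem IsPath.right_unique {u w w' : V} {p : List E} (h : G.IsPath u p w)
    (h' : G.IsPath u p w') : w = w' := by
  induction h with
  | nil v => cases h'; rfl
  | cons e _ ih =>
    generalize G.s e = u at h'
    cases h' with
    | cons _ h' => exact ih h'

/-- The segment of length `n` of an infinite path that starts with its `m`-th edge. -/
def segment (f : ℕ → E) (m n : ℕ) : List E := (List.range n).map fun k => f (m + k)

theorem length_segment (f : ℕ → E) (m n : ℕ) : (segment f m n).length = n := by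
  simp [segment]

theorem segment_add (f : ℕ → E) (m n k : ℕ) :
    segment f m (n + k) = segment f m n ++ segment f (m + n) k := by
  simp [segment, List.range_add, add_assoc]

theorem IsInfinitePath.isPath {f : ℕ → E} (hf : G.IsInfinitePath f) (m n : ℕ) :
    G.IsPath (G.s (f m)) (segment f m n) (G.s (f (m + n))) := by
  induction n with
  | zero => exact .nil _
  | succ n ih =>
    rw [segment, List.range_succ, List.map_append, ← add_assoc, ← hf (m + n)]
    exact ih.snoc

/-- The range of each edge is the source of the cyclically next one, so the sources already exhaust
the vertices of a cycle. -/
theorem IsCycle.exists_source {p : List E} (hc : G.IsCycle p) {v : V} (hv : v ∈ G.pathVertices p) :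
    ∃ e ∈ p, G.s e = v := by
  obtain ⟨⟨hne, hchain⟩, ⟨_, hclosed⟩, -⟩ := hc
  obtain ⟨e, he, rfl | rfl⟩ := hv
  · exact ⟨e, he, rfl⟩
  · obtain ⟨i, hi, rfl⟩ := List.mem_iff_getElem.1 he
    by_cases hi' : i + 1 < p.length
    · exact ⟨p[i + 1], List.getElem_mem _, (List.isChain_iff_getElem.1 hchain i hi').symm⟩
    · refine ⟨p.head hne, List.head_mem _, ?_⟩
      rw [← hclosed, List.getLast_eq_getElem]
      congr 2
      omega

/-- In a cycle without exits, an edge that starts on the cycle belongs to it. -/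
theorem IsCycle.mem_of_source_mem {p : List E} (hc : G.IsCycle p) (hexit : ¬ G.HasExit p) {e : E}
    (he : G.s e ∈ G.pathVertices p) : e ∈ p := by
  obtain ⟨f, hf, hfe⟩ := hc.exists_source he
  by_contra h
  exact hexit ⟨f, hf, e, hfe.symm, fun h' => h (h' ▸ hf)⟩

/-- Each edge that starts on the cycle is an edge of the cycle, so a path that has entered it stays
there. -/
theorem IsCycle.mem_pathVertices_of_isPath {p : List E} (hc : G.IsCycle p)
    (hexit : ¬ G.HasExit p) {u w : V} {q : List E} (hq : G.IsPath u q w)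
    (hu : u ∈ G.pathVertices p) : w ∈ G.pathVertices p := by
  induction hq with
  | nil v => exact hu
  | cons e _ ih => exact ih ⟨e, hc.mem_of_source_mem hexit hu, Or.inr rfl⟩

/-- An infinite path that meets a cycle without exits ends in it. -/
theorem IsCycle.endsIn {p : List E} (hc : G.IsCycle p) (hexit : ¬ G.HasExit p) {f : ℕ → E}
    (hf : G.IsInfinitePath f) {n : ℕ} (hn : G.s (f n) ∈ G.pathVertices p) : EndsIn f p := by
  obtain ⟨i, hi, hci⟩ := List.mem_iff_getElem.1 (hc.mem_of_source_mem hexit hn)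
  have hpos : 0 < p.length := by omega
  -- Without exits the continuation is forced: after `p[j]` only the cyclically next edge is
  -- available.
  have step : ∀ j (hj : j < p.length) (e : E), G.r p[j] = G.s e →
      p[(j + 1) % p.length]? = some e := by
    intro j hj e he
    have hlt : (j + 1) % p.length < p.length := Nat.mod_lt _ hpos
    rw [List.getElem?_eq_getElem hlt]
    have hs : G.r p[j] = G.s (p[(j + 1) % p.length]'hlt) := by
      by_cases hj' : j + 1 < p.length
      · have := List.isChain_iff_getElem.1 hc.1.2 j hj'
        simp only [Nat.mod_eq_of_lt hj']
        exact this
      · obtain ⟨hne, hclosed⟩ := hc.2.1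
        have hj1 : j + 1 = p.length := by omega
        simp only [hj1, Nat.mod_self]
        rw [List.getLast_eq_getElem, List.head_eq_getElem] at hclosed
        rw [← hclosed]
        congr 2
        omega
    by_contra hne
    exact hexit ⟨_, List.getElem_mem hlt, e, by rw [← he, hs], fun h => hne (by rw [h])⟩
  have main : ∀ k, p[(i + k) % p.length]? = some (f (n + k)) := by
    intro k
    induction k with
    | zero => rw [add_zero, add_zero, Nat.mod_eq_of_lt hi, List.getElem?_eq_getElem hi, hci]
    | succ k ih =>
      have hlt : (i + k) % p.length < p.length := Nat.mod_lt _ hpos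
      rw [List.getElem?_eq_getElem hlt, Option.some_inj] at ih
      have := step _ hlt (f (n + k + 1)) (by rw [ih]; exact hf _)
      rwa [Nat.mod_add_mod, add_assoc] at this
  -- The path meets `p` at its `i`-th edge; `p.length - i` further steps bring it to edge `0`, as
  -- `EndsIn` compares with `p` itself and not with a rotation.
  refine ⟨n + (p.length - i), fun k => ?_⟩
  have := main (p.length - i + k)
  rwa [← add_assoc, Nat.add_sub_cancel' hi.le, Nat.add_mod_left, ← add_assoc] at this

/-- An infinite path that revisits a vertex passes through a cycle. -/
theorem IsInfinitePath.exists_isCycle {f : ℕ → E} (hf : G.IsInfinitePath f)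
    (h : ¬ Function.Injective (G.s ∘ f)) : ∃ i, ∃ d, G.IsCycle d ∧ f i ∈ d := by
  classical
  -- A return of least length `l + 1`, over all starting positions, has no repeated source inside it
  -- and is therefore a cycle.
  have hex : ∃ l, ∃ i, G.s (f i) = G.s (f (i + (l + 1))) := by
    simp only [Function.Injective, not_forall] at h
    obtain ⟨i, j, hij, hne⟩ := h
    rcases Nat.lt_or_gt_of_ne hne with hlt | hlt
    · exact ⟨j - i - 1, i, by rw [show i + (j - i - 1 + 1) = j by omega]; exact hij⟩
    · exact ⟨i - j - 1, j, by rw [show j + (i - j - 1 + 1) = i by omega]; exact hij.symm⟩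
  obtain ⟨i, hi⟩ := Nat.find_spec hex
  set l := Nat.find hex
  have hmin : ∀ m < l, ∀ i, G.s (f i) ≠ G.s (f (i + (m + 1))) := fun m hm i h' =>
    Nat.find_min hex hm ⟨i, h'⟩
  have hne : segment f i (l + 1) ≠ [] := List.ne_nil_of_length_pos (by simp [length_segment])
  refine ⟨i, segment f i (l + 1), ⟨⟨hne, ?_⟩, ⟨hne, ?_⟩, ?_⟩, ?_⟩
  · rw [List.isChain_iff_getElem]
    intro k hk
    simpa [segment, add_assoc] using hf (i + k)
  · have h0 : G.r (f (i + l)) = G.s (f i) := by rw [hf, hi]; rfl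
    rw [List.getLast_eq_getElem, List.head_eq_getElem]
    simpa [segment] using h0
  · rw [segment, List.map_map]
    refine List.Nodup.map_on ?_ List.nodup_range
    have aux : ∀ x y, x < y → y < l + 1 → G.s (f (i + x)) ≠ G.s (f (i + y)) := by
      intro x y hxy hy
      have := hmin (y - x - 1) (by omega) (i + x)
      rwa [show i + x + (y - x - 1 + 1) = i + y by omega] at this
    intro x hx y hy hxy
    simp only [List.mem_range] at hx hy
    rcases Nat.lt_trichotomy x y with hlt | heq | hlt
    · exact (aux x y hlt hy hxy).elim
    · exact heq
    · exact (aux y x hlt hx hxy.symm).elim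
  · exact List.mem_map.2 ⟨0, by simp, rfl⟩

end DirectedGraph

/-! ### Monomials `p q*` and the common descendant property -/

namespace LeavittPathAlgebra

variable (K : Type*) [Field K] {V E : Type*} (G : DirectedGraph V E)

/-- The element of the Leavitt path algebra given by a path `p` with source `u`. -/
def path (u : V) : List E → LeavittPathAlgebra K G
  | [] => gen K G (.vertex u)
  | e :: p => gen K G (.edge e) * path (G.r e) p

/-- The element of the Leavitt path algebra given by the ghost of a path `p` with source `u`. -/
def ghostPath (u : V) : List E → LeavittPathAlgebra K G
  | [] => gen K G (.vertex u)
  | e :: p => ghostPath (G.r e) p * gen K G (.ghost e)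

variable {K G}

theorem gen_vertex_mul_self (v : V) :
    gen K G (.vertex v) * gen K G (.vertex v) = gen K G (.vertex v) :=
  (isLeavittFamily_gen K G).vertex_mul_self v

theorem gen_vertex_mul_ne {v w : V} (h : v ≠ w) :
    gen K G (.vertex v) * gen K G (.vertex w) = 0 :=
  (isLeavittFamily_gen K G).vertex_mul_ne v w h

theorem source_mul_edge (e : E) :
    gen K G (.vertex (G.s e)) * gen K G (.edge e) = gen K G (.edge e) :=
  (isLeavittFamily_gen K G).source_mul_edge e

theorem edge_mul_range (e : E) :
    gen K G (.edge e) * gen K G (.vertex (G.r e)) = gen K G (.edge e) :=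
  (isLeavittFamily_gen K G).edge_mul_range e

theorem range_mul_ghost (e : E) :
    gen K G (.vertex (G.r e)) * gen K G (.ghost e) = gen K G (.ghost e) :=
  (isLeavittFamily_gen K G).range_mul_ghost e

theorem ghost_mul_source (e : E) :
    gen K G (.ghost e) * gen K G (.vertex (G.s e)) = gen K G (.ghost e) :=
  (isLeavittFamily_gen K G).ghost_mul_source e

theorem ghost_mul_edge_self (e : E) :
    gen K G (.ghost e) * gen K G (.edge e) = gen K G (.vertex (G.r e)) :=
  (isLeavittFamily_gen K G).ck1_self e

theorem ghost_mul_edge_ne {e f : E} (h : e ≠ f) :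
    gen K G (.ghost e) * gen K G (.edge f) = 0 :=
  (isLeavittFamily_gen K G).ck1_ne e f h

variable {u v w : V} {p q : List E}

theorem source_mul_path (h : G.IsPath u p w) :
    gen K G (.vertex u) * path K G u p = path K G u p := by
  cases h with
  | nil => exact gen_vertex_mul_self _
  | cons e _ => rw [path, ← mul_assoc, source_mul_edge]

theorem ghostPath_mul_source (h : G.IsPath u p w) :
    ghostPath K G u p * gen K G (.vertex u) = ghostPath K G u p := by
  cases h with
  | nil => exact gen_vertex_mul_self _
  | cons e _ => rw [ghostPath, mul_assoc, ghost_mul_source]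

theorem range_mul_ghostPath (h : G.IsPath u p w) :
    gen K G (.vertex w) * ghostPath K G u p = ghostPath K G u p := by
  induction h with
  | nil => exact gen_vertex_mul_self _
  | cons e _ ih => rw [ghostPath, ← mul_assoc, ih]

theorem path_append (hp : G.IsPath u p v) (hq : G.IsPath v q w) :
    path K G u (p ++ q) = path K G u p * path K G v q := by
  induction hp with
  | nil => exact (source_mul_path hq).symm
  | cons e _ ih => rw [List.cons_append, path, path, ih hq, mul_assoc]

theorem ghostPath_append (hp : G.IsPath u p v) (hq : G.IsPath v q w) :
    ghostPath K G u (p ++ q) = ghostPath K G v q * ghostPath K G u p := by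
  induction hp with
  | nil => exact (ghostPath_mul_source hq).symm
  | cons e _ ih => rw [List.cons_append, ghostPath, ghostPath, ih hq, mul_assoc]

theorem ghost_mul_ghostPath {e : E} (hp : G.IsPath u p (G.s e)) :
    gen K G (.ghost e) * ghostPath K G u p = ghostPath K G u (p ++ [e]) := by
  rw [ghostPath_append hp (.cons e (.nil _)), ghostPath, ghostPath, range_mul_ghost]

theorem ghostPath_mul_path_self (hp : G.IsPath u p w) :
    ghostPath K G u p * path K G u p = gen K G (.vertex w) := by
  induction hp with
  | nil => exact gen_vertex_mul_self _
  | cons e h ih =>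
    rw [ghostPath, path, mul_assoc, ← mul_assoc (gen K G (.ghost e)), ghost_mul_edge_self,
      source_mul_path h, ih]

/-- Distinct paths of the same length are orthogonal. -/
theorem ghostPath_mul_path_of_ne (hp : G.IsPath u p v) (hq : G.IsPath u q w)
    (hlen : p.length = q.length) (hne : p ≠ q) : ghostPath K G u p * path K G u q = 0 := by
  induction hp generalizing q with
  | nil => exact (hne (List.length_eq_zero_iff.1 hlen.symm).symm).elim
  | cons e h ih =>
    generalize G.s e = u' at hq
    cases hq with
    | nil => simp at hlen
    | cons f hq =>
      rw [ghostPath, path, mul_assoc, ← mul_assoc (gen K G (.ghost e))]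
      by_cases hef : e = f
      · subst hef
        rw [ghost_mul_edge_self, source_mul_path hq]
        exact ih hq (by simpa using hlen) (by simpa using hne)
      · rw [ghost_mul_edge_ne hef, zero_mul, mul_zero]

variable (K G) in
/-- The span of the monomials `p q*` with `p` and `q` paths that have the same range. -/
def monomialSpan : Submodule K (LeavittPathAlgebra K G) :=
  Submodule.span K {x | ∃ u p v q w, G.IsPath u p w ∧ G.IsPath v q w ∧
    x = path K G u p * ghostPath K G v q}

theorem path_mul_ghostPath_mem (hp : G.IsPath u p w) (hq : G.IsPath v q w) :
    path K G u p * ghostPath K G v q ∈ monomialSpan K G :=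
  Submodule.subset_span ⟨u, p, v, q, w, hp, hq, rfl⟩

/-- An edge lengthens `p`. A ghost edge cancels the first edge of `p` or kills the product; if `p`
is trivial, it lengthens `q` instead. All mismatched products vanish. -/
theorem gen_mul_monomial_mem (g : LeavittGen V E) (hp : G.IsPath u p w) (hq : G.IsPath v q w) :
    gen K G g * (path K G u p * ghostPath K G v q) ∈ monomialSpan K G := by
  -- Inserting the source idempotent of `p` reduces every mismatch of endpoints to orthogonality of
  -- vertices.
  rw [← source_mul_path hp, ← mul_assoc, ← mul_assoc]
  cases g with
  | vertex x =>
    by_cases h : x = u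
    · subst h
      rw [gen_vertex_mul_self, source_mul_path hp]
      exact path_mul_ghostPath_mem hp hq
    · rw [gen_vertex_mul_ne h, zero_mul, zero_mul]
      exact zero_mem _
  | edge e =>
    by_cases h : G.r e = u
    · subst h
      rw [edge_mul_range]
      exact path_mul_ghostPath_mem (.cons e hp) hq
    · rw [← edge_mul_range e, mul_assoc (gen K G (.edge e)), gen_vertex_mul_ne h]
      simp
  | ghost e =>
    by_cases h : G.s e = u
    · subst h
      rw [ghost_mul_source]
      generalize hu : G.s e = u at hp
      cases hp with
      | nil =>
        subst hu
        rw [path, ghost_mul_source, ghost_mul_ghostPath hq, ← range_mul_ghostPath hq.snoc]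
        exact path_mul_ghostPath_mem (.nil _) hq.snoc
      | cons f hp =>
        rw [path, ← mul_assoc]
        by_cases hef : e = f
        · subst hef
          rw [ghost_mul_edge_self, source_mul_path hp]
          exact path_mul_ghostPath_mem hp hq
        · rw [ghost_mul_edge_ne hef]
          simp
    · rw [← ghost_mul_source e, mul_assoc (gen K G (.ghost e)), gen_vertex_mul_ne h]
      simp

theorem gen_mem_monomialSpan (g : LeavittGen V E) : gen K G g ∈ monomialSpan K G := by
  have hv : ∀ v, gen K G (.vertex v) ∈ monomialSpan K G := fun v => by
    have := path_mul_ghostPath_mem (K := K) (G := G) (.nil v) (.nil v)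
    rwa [path, ghostPath, gen_vertex_mul_self] at this
  cases g with
  | vertex v => exact hv v
  | edge e =>
    have := path_mul_ghostPath_mem (K := K) (G := G) (.cons e (.nil _)) (.nil _)
    rwa [path, path, ghostPath, edge_mul_range, edge_mul_range] at this
  | ghost e =>
    have := path_mul_ghostPath_mem (K := K) (G := G) (.nil _) (.cons e (.nil _))
    rwa [path, ghostPath, ghostPath, range_mul_ghost, range_mul_ghost] at this

/-- An induction principle for the Leavitt path algebra. -/
theorem induction {C : LeavittPathAlgebra K G → Prop} (mem : ∀ g, C (gen K G g)) (zero : C 0)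
    (add : ∀ x y, C x → C y → C (x + y)) (mul : ∀ x y, C x → C y → C (x * y))
    (smul : ∀ (k : K) x, C x → C (k • x)) (x : LeavittPathAlgebra K G) : C x := by
  obtain ⟨x, hx⟩ := x
  induction hx using NonUnitalAlgebra.adjoin_induction with
  | mem x hx => obtain ⟨g, rfl⟩ := hx; exact mem g
  | add x y _ _ hx hy => exact add _ _ hx hy
  | zero => exact zero
  | mul x y _ _ hx hy => exact mul _ _ hx hy
  | smul k x _ hx => exact smul _ _ hx

/-- The monomials `p q*` span the Leavitt path algebra. -/
theorem mem_monomialSpan (x : LeavittPathAlgebra K G) : x ∈ monomialSpan K G := by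
  -- The span is a left ideal, so a product lies in it as soon as its right factor does.
  have key : ∀ x : LeavittPathAlgebra K G, ∀ y ∈ monomialSpan K G, x * y ∈ monomialSpan K G := by
    intro x
    induction x using induction with
    | mem g =>
      intro y hy
      induction hy using Submodule.span_induction with
      | mem y hy =>
        obtain ⟨u, p, v, q, w, hp, hq, rfl⟩ := hy
        exact gen_mul_monomial_mem g hp hq
      | zero => rw [mul_zero]; exact zero_mem _
      | add y z _ _ hy hz => rw [mul_add]; exact add_mem hy hz
      | smul k y _ hy => rw [mul_smul_comm]; exact Submodule.smul_mem _ _ hy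
    | zero => intro y _; rw [zero_mul]; exact zero_mem _
    | add x x' hx hx' => intro y hy; rw [add_mul]; exact add_mem (hx y hy) (hx' y hy)
    | mul x x' hx hx' => intro y hy; rw [mul_assoc]; exact hx _ (hx' y hy)
    | smul k x hx => intro y hy; rw [smul_mul_assoc]; exact Submodule.smul_mem _ _ (hx y hy)
  induction x using induction with
  | mem g => exact gen_mem_monomialSpan g
  | zero => exact zero_mem _
  | add x y hx hy => exact add_mem hx hy
  | mul x y _ hy => exact key x y hy
  | smul k x hx => exact Submodule.smul_mem _ _ hx

/-- In a prime Leavitt path algebra of a row-finite graph, any two vertices connect to a common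
vertex. -/
theorem exists_common_descendant (hrow : G.RowFinite)
    (hprime : IsPrimeRing (LeavittPathAlgebra K G)) (u v : V) :
    ∃ p q w, G.IsPath u p w ∧ G.IsPath v q w := by
  by_contra hcon
  push Not at hcon
  -- A monomial `p q*` survives between `u` and `v` only if `p` starts at `u` and `q` at `v`; their
  -- common range would be a common descendant.
  have hzero : ∀ a, gen K G (.vertex u) * a * gen K G (.vertex v) = 0 := by
    intro a
    induction mem_monomialSpan a using Submodule.span_induction with
    | mem a ha =>
      obtain ⟨u', p, v', q, w, hp, hq, rfl⟩ := ha
      by_cases hu : u = u'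
      · subst hu
        have hv : v' ≠ v := by
          rintro rfl
          exact hcon p q w hp hq
        rw [mul_assoc, mul_assoc, ← ghostPath_mul_source hq, mul_assoc, gen_vertex_mul_ne hv]
        simp
      · rw [← source_mul_path hp, mul_assoc (gen K G (.vertex u')), ← mul_assoc,
          gen_vertex_mul_ne hu]
        simp
    | zero => simp
    | add a b _ _ ha hb => rw [mul_add, add_mul, ha, hb, add_zero]
    | smul k a _ ha => rw [mul_smul_comm, smul_mul_assoc, ha, smul_zero]
  rcases hprime.eq_zero_or_eq_zero (gen_vertex_mul_self u) hzero with h | h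
  · exact gen_vertex_ne_zero hrow u h
  · exact gen_vertex_ne_zero hrow v h

end LeavittPathAlgebra

/-! ### Compression along an infinite path -/

namespace LeavittPathAlgebra

open DirectedGraph

variable {K : Type*} [Field K] {V E : Type*} {G : DirectedGraph V E} {u w : V} {p : List E}
  {f : ℕ → E}

/-- Cutting the segment after `p.length` edges leaves two distinct paths of equal length, which are
orthogonal. -/
theorem ghostPath_mul_path_segment (hf : G.IsInfinitePath f) (hp : G.IsPath (G.s (f 0)) p w)
    {n : ℕ} (hn : p.length ≤ n) (hne : p ≠ segment f 0 p.length) :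
    ghostPath K G (G.s (f 0)) p * path K G (G.s (f 0)) (segment f 0 n) = 0 := by
  obtain ⟨k, rfl⟩ := Nat.exists_eq_add_of_le hn
  have h1 := hf.isPath 0 p.length
  have h2 := hf.isPath (0 + p.length) k
  rw [segment_add, path_append h1 h2, ← mul_assoc,
    ghostPath_mul_path_of_ne hp h1 (length_segment ..).symm hne, zero_mul]

theorem ghostPath_segment_mul_path (hf : G.IsInfinitePath f) (hp : G.IsPath (G.s (f 0)) p w)
    {n : ℕ} (hn : p.length ≤ n) (hne : p ≠ segment f 0 p.length) :
    ghostPath K G (G.s (f 0)) (segment f 0 n) * path K G (G.s (f 0)) p = 0 := by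
  obtain ⟨k, rfl⟩ := Nat.exists_eq_add_of_le hn
  have h1 := hf.isPath 0 p.length
  have h2 := hf.isPath (0 + p.length) k
  rw [segment_add, ghostPath_append h1 h2, mul_assoc,
    ghostPath_mul_path_of_ne h1 hp (length_segment ..) hne.symm, mul_zero]

/-- Compressing an element of the Leavitt path algebra by long initial segments of an infinite path
without repeated vertices yields a scalar multiple of a vertex. -/
theorem exists_compression_eq_smul (hf : G.IsInfinitePath f)
    (hinj : Function.Injective (G.s ∘ f)) (x : LeavittPathAlgebra K G) :
    ∃ N, ∀ n ≥ N, ∃ k : K,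
      ghostPath K G (G.s (f 0)) (segment f 0 n) * x * path K G (G.s (f 0)) (segment f 0 n) =
        k • gen K G (.vertex (G.s (f n))) := by
  have hseg : ∀ n, G.IsPath (G.s (f 0)) (segment f 0 n) (G.s (f n)) := fun n => by
    have := hf.isPath 0 n
    rwa [zero_add] at this
  induction mem_monomialSpan x using Submodule.span_induction with
  | mem x hx =>
    obtain ⟨u, p, v, q, w, hp, hq, rfl⟩ := hx
    refine ⟨max p.length q.length, fun n hn => ?_⟩
    have hpn : p.length ≤ n := (le_max_left ..).trans hn
    have hqn : q.length ≤ n := (le_max_right ..).trans hn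
    by_cases hu : G.s (f 0) = u
    swap
    · refine ⟨0, ?_⟩
      rw [← ghostPath_mul_source (hseg n), ← source_mul_path hp, ← mul_assoc, ← mul_assoc,
        mul_assoc (ghostPath ..), gen_vertex_mul_ne hu]
      simp
    by_cases hv : v = G.s (f 0)
    swap
    · refine ⟨0, ?_⟩
      rw [← ghostPath_mul_source hq, ← source_mul_path (hseg n), mul_assoc, mul_assoc, mul_assoc,
        ← mul_assoc (gen K G (.vertex v)), gen_vertex_mul_ne hv]
      simp
    subst hu hv
    by_cases hp' : p = segment f 0 p.length
    swap
    · refine ⟨0, ?_⟩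
      rw [← mul_assoc, ghostPath_segment_mul_path hf hp hpn hp', zero_mul, zero_mul, zero_smul]
    by_cases hq' : q = segment f 0 q.length
    swap
    · refine ⟨0, ?_⟩
      rw [mul_assoc, mul_assoc, ghostPath_mul_path_segment hf hq hqn hq', mul_zero, mul_zero,
        zero_smul]
    have hpw : w = G.s (f p.length) := by
      have := hseg p.length
      rw [← hp'] at this
      exact hp.right_unique this
    have hqw : w = G.s (f q.length) := by
      have := hseg q.length
      rw [← hq'] at this
      exact hq.right_unique this
    -- Here distinctness of the vertices is used: the common range `w` occurs only once on the path,
    -- so it determines the length of the initial segment.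
    have hlen : p.length = q.length := hinj (hpw.symm.trans hqw)
    have hpq : p = q := by rw [hp', hq', hlen]
    subst hpq
    refine ⟨1, ?_⟩
    obtain ⟨k, rfl⟩ := Nat.exists_eq_add_of_le hpn
    have hk : G.IsPath w (segment f (0 + p.length) k) (G.s (f (p.length + k))) := by
      have := hf.isPath (0 + p.length) k
      rw [zero_add, ← hpw] at this
      rwa [zero_add]
    rw [segment_add, ← hp', path_append hp hk, ghostPath_append hp hk,
      mul_assoc, mul_assoc, mul_assoc, ← mul_assoc (ghostPath K G _ p),
      ghostPath_mul_path_self hp, ← mul_assoc (ghostPath K G _ p), ghostPath_mul_path_self hp,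
      source_mul_path hk, source_mul_path hk, ghostPath_mul_path_self hk, one_smul]
  | zero => exact ⟨0, fun n _ => ⟨0, by simp⟩⟩
  | add x y _ _ hx hy =>
    obtain ⟨M, hM⟩ := hx
    obtain ⟨N, hN⟩ := hy
    -- The two compressions can be added because both are scalars for every large `n`, hence for a
    -- common one.
    refine ⟨max M N, fun n hn => ?_⟩
    obtain ⟨k, hk⟩ := hM n ((le_max_left ..).trans hn)
    obtain ⟨l, hl⟩ := hN n ((le_max_right ..).trans hn)
    exact ⟨k + l, by rw [mul_add, add_mul, hk, hl, add_smul]⟩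
  | smul c x _ hx =>
    obtain ⟨N, hN⟩ := hx
    refine ⟨N, fun n hn => ?_⟩
    obtain ⟨k, hk⟩ := hN n hn
    exact ⟨c * k, by rw [mul_smul_comm, smul_mul_assoc, hk, mul_smul]⟩

/-- An element of the centroid acts as a scalar on some vertex of an infinite path without repeated
vertices. -/
theorem exists_centroid_apply_eq_smul (hf : G.IsInfinitePath f)
    (hinj : Function.Injective (G.s ∘ f)) {τ : Module.End K (LeavittPathAlgebra K G)}
    (hτ : τ ∈ centroid K (LeavittPathAlgebra K G)) :
    ∃ (n : ℕ) (k : K), τ (gen K G (.vertex (G.s (f n)))) = k • gen K G (.vertex (G.s (f n))) := by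
  obtain ⟨N, hN⟩ := exists_compression_eq_smul hf hinj (τ (gen K G (.vertex (G.s (f 0)))))
  obtain ⟨k, hk⟩ := hN N le_rfl
  refine ⟨N, k, ?_⟩
  have hseg := hf.isPath 0 N
  rw [zero_add] at hseg
  -- With `γ` the segment and `v₀` its source, `γ* (τ v₀) γ = τ (γ* v₀ γ) = τ (γ* γ)`, and `γ* γ` is
  -- the vertex where `γ` ends.
  rw [← hk, ← (hτ _ _).2, ← (hτ _ _).1, ghostPath_mul_source hseg, ghostPath_mul_path_self hseg]

end LeavittPathAlgebra

/-! ### The comet dichotomy and the conclusion -/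

/-- In a graph whose only cycle has no exits and is reached from every vertex, either the graph is a
comet or there is an infinite path without repeated vertices. -/
theorem DirectedGraph.IsUniqueCycle.exists_injective_infinitePath {V E : Type*}
    {G : DirectedGraph V E} {c : List E} (hc : G.IsUniqueCycle c) (hexit : ¬ G.HasExit c)
    (hreach : ∀ v, (G.tree v ∩ G.pathVertices c).Nonempty) (hcomet : ¬ G.IsComet) :
    ∃ f : ℕ → E, G.IsInfinitePath f ∧ Function.Injective (G.s ∘ f) := by
  by_contra hcon
  refine hcomet ⟨c, hc, hreach, fun f hf => ?_⟩
  obtain ⟨i, d, hd, hi⟩ := hf.exists_isCycle fun h => hcon ⟨f, hf, h⟩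
  -- The cycle `d` met by `f` is a rotation of `c`, so it has the same edges.
  exact hc.1.endsIn hexit hf ⟨f i, (hc.2 d hd).mem_iff.1 hi, Or.inl rfl⟩

theorem mainTheorem9 {K : Type*} [Field K] {V E : Type*} (G : DirectedGraph V E)
    (hrow : G.RowFinite) (hprime : IsPrimeRing (LeavittPathAlgebra K G))
    (c : List E) (hc : G.IsUniqueCycle c) (hexit : ¬ G.HasExit c) (hcomet : ¬ G.IsComet) :
    Nonempty (centroid K (LeavittPathAlgebra K G) ≃ₐ[K] K) := by
  obtain ⟨e, he⟩ := List.exists_mem_of_ne_nil c hc.1.1.1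
  have hreach : ∀ v, (G.tree v ∩ G.pathVertices c).Nonempty := by
    intro v
    -- A common descendant of `v` and a vertex of the cycle lies on the cycle.
    obtain ⟨p, q, w, hp, hq⟩ :=
      LeavittPathAlgebra.exists_common_descendant hrow hprime v (G.s e)
    exact ⟨w, hp.connects,
      hc.1.mem_pathVertices_of_isPath hexit hq ⟨e, he, Or.inl rfl⟩⟩
  obtain ⟨f, hf, hinj⟩ := hc.exists_injective_infinitePath hexit hreach hcomet
  have : Nontrivial (LeavittPathAlgebra K G) :=
    ⟨_, 0, LeavittPathAlgebra.gen_vertex_ne_zero hrow (G.s e)⟩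
  refine nonempty_centroid_algEquiv (A := LeavittPathAlgebra K G) fun τ hτ => ?_
  obtain ⟨n, k, hk⟩ := LeavittPathAlgebra.exists_centroid_apply_eq_smul hf hinj hτ
  exact ⟨k, eq_algebraMap_of_mem_centroid hprime hτ
    (LeavittPathAlgebra.gen_vertex_ne_zero hrow (G.s (f n))) hk⟩
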